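/- Let $k$ be an algebraically closed field of characteristic $0$, let $g\ge 2$, and let $\mathcal X_g$ be the hyperelliptic curve $Y^2=f(X)$ over $k$, where $f=\sum_i a_iX^i\in k[X]$ is squarefree of degree $2g+1$ or $2g+2$. Let $K=k(X)(\sqrt f)$ be its function field, $\mathrm{Aut}(\mathcal X_g)=\mathrm{Aut}(K/k)$, and let the reduced automorphism group be $\overline{\mathrm{Aut}}(\mathcal X_g)=\mathrm{Aut}(K/k)/\mathrm{Gal}(K/k(X))$, the quotient by the group generated by the hyperelliptic involution. Put $d=2g+2$ and let $F(X,Z)=\sum_{i=0}^{d}a_iX^iZ^{d-i}$. For binary forms $p,q$ of degrees $n,m$ and $r\le \min(n,m)$ let $$(p,q)^r=\frac{(m-r)!\,(n-r)!}{n!\,m!}\sum_{i=0}^r(-1)^i\binom ri\frac{\partial^r p}{\partial X^{r-i}\partial Z^i}\cdot\frac{\partial^r q}{\partial X^i\partial Z^{r-i}} ,$$ and set $J_4=(F,F)^{d-2}$ (a form of degree $4$) and $I_4(\mathcal X_g)=(J_4,J_4)^4\in k$. If $\overline{\mathrm{Aut}}(\mathcal X_g)\cong A_4$, then $I_4(\mathcal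 X_g)=0$. In particular, if $\mathrm{Aut}(\mathcal X_g)\cong \mathbb Z_2\oplus A_4$ or $\mathrm{Aut}(\mathcal X_g)\cong SL_2(3)$, where $SL_2(3)=SL_2(\mathbb F_3)$, then $I_4(\mathcal X_g)=0$. -/

import Mathlib

open Polynomial

/-- A hyperelliptic curve of genus `g ≥ 2` over `k`, given by an equation `Y ^ 2 = f(X)` with `f`
squarefree of degree `2 * g + 1` or `2 * g + 2` (in the first case one of the `2 * g + 2`
branch points on the projective line is the point at infinity). -/
structure HyperellipticCurve (k : Type*) [Field k] where
  /-- the genus -/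
  g : ℕ
  two_le_g : 2 ≤ g
  /-- the right-hand side of the equation `Y ^ 2 = f(X)` -/
  f : k[X]
  squarefree_f : Squarefree f
  natDegree_f : f.natDegree = 2 * g + 1 ∨ f.natDegree = 2 * g + 2

namespace HyperellipticCurve

/-! ### Automorphisms of quadratic extensions of `k(X)` -/

section Auxiliary

variable {k : Type*} [Field k]

theorem dvd_of_sq_mul {f D : k[X]} (hf : Squarefree f) (h : RatFunc k)
    (e : algebraMap k[X] (RatFunc k) D = h ^ 2 * algebraMap k[X] (RatFunc k) f) : f ∣ D := by
  have hint : IsIntegral k[X] (h * algebraMap k[X] (RatFunc k) f) := by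
    refine ⟨X ^ 2 - C (D * f), monic_X_pow_sub_C _ two_ne_zero, ?_⟩
    simp only [eval₂_sub, eval₂_X_pow, eval₂_C]
    rw [map_mul, e]
    ring
  obtain ⟨p, hp⟩ := IsIntegrallyClosed.isIntegral_iff.mp hint
  have h1 : p ^ 2 = D * f := by
    apply IsFractionRing.injective k[X] (RatFunc k)
    rw [map_pow, hp, map_mul, e]; ring
  have h2 : f ∣ p := (hf.dvd_pow_iff_dvd two_ne_zero).1 ⟨D, by rw [h1, mul_comm]⟩
  obtain ⟨q, rfl⟩ := h2
  have hf0 : f ≠ 0 := hf.ne_zero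
  refine ⟨q ^ 2, mul_left_cancel₀ hf0 ?_⟩
  rw [mul_comm f D, ← h1]; ring

theorem sq_ne_algebraMap {f : k[X]} (hf : Squarefree f) (hd : f.natDegree ≠ 0) (h : RatFunc k) :
    h ^ 2 ≠ algebraMap k[X] (RatFunc k) f := by
  intro e
  have hf0 : f ≠ 0 := hf.ne_zero
  have h0 : h ≠ 0 := by
    rintro rfl
    apply hf0
    apply IsFractionRing.injective k[X] (RatFunc k)
    rw [← e]; simp
  have := dvd_of_sq_mul (D := 1) hf h⁻¹ (by rw [← e, map_one]; field_simp)
  exact hd (natDegree_eq_zero_of_isUnit (isUnit_of_dvd_one this))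

theorem coeff_coeff_swap (P : k[X][X]) (i j : ℕ) :
    ((Bivariate.swap P).coeff j).coeff i = (P.coeff i).coeff j := by
  induction P using Polynomial.induction_on' with
  | add p q hp hq => simp [hp, hq]
  | monomial n a =>
    induction a using Polynomial.induction_on' with
    | add p q hp hq => simp only [map_add, coeff_add, hp, hq]
    | monomial m r =>
      rw [Bivariate.swap_monomial_monomial]
      simp only [coeff_monomial]
      split_ifs <;> simp_all [coeff_monomial]

theorem exists_irreducible_dvd {A B : Type*} [CommRing A] [IsDomain A]
    [UniqueFactorizationMonoid A] [CommRing B] [IsDomain B] (φ : A →+* B) {Q : A} (hQ : Q ≠ 0)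
    (h : φ Q = 0) : ∃ P, Irreducible P ∧ P ∣ Q ∧ φ P = 0 := by
  obtain ⟨m, hm, u, hu⟩ := WfDvdMonoid.exists_factors Q hQ
  have h1 : φ m.prod = 0 := by
    rw [← hu, map_mul] at h
    exact (mul_eq_zero.1 h).resolve_right ((u.isUnit.map φ).ne_zero)
  rw [map_multiset_prod, Multiset.prod_eq_zero_iff, Multiset.mem_map] at h1
  obtain ⟨P, hP, h0⟩ := h1
  exact ⟨P, hm P hP, (Multiset.dvd_prod hP).trans ⟨u, hu.symm⟩, h0⟩

theorem quad_rel {K : Type*} [Field K] [CharZero k] [Algebra (RatFunc k) K] {f : k[X]} {y : K}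
    (hy : y ^ 2 = algebraMap (RatFunc k) K (algebraMap k[X] (RatFunc k) f))
    (a b : RatFunc k) :
    ∃ r s : RatFunc k, ∀ u : K,
      u = algebraMap (RatFunc k) K a + algebraMap (RatFunc k) K b * y →
      u ^ 2 + algebraMap (RatFunc k) K r * u + algebraMap (RatFunc k) K s = 0 := by
  refine ⟨-(2 * a), a ^ 2 - b ^ 2 * algebraMap k[X] (RatFunc k) f, ?_⟩
  rintro u rfl
  simp only [map_neg, map_mul, map_sub, map_pow, ← hy, map_ofNat]
  ring

/-- Every `k`-automorphism of a quadratic extension `K = k(x)(√f)` of the rational function field,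
with `f` squarefree of degree at least `5`, maps `x` into `k(x)`. -/
theorem map_X_mem_range {K : Type*} [Field K] [CharZero k] [Algebra k K] [Algebra (RatFunc k) K]
    [IsScalarTower k (RatFunc k) K] {f : k[X]} (hf : Squarefree f) (hd : 5 ≤ f.natDegree) {y : K}
    (hy : y ^ 2 = algebraMap (RatFunc k) K (algebraMap k[X] (RatFunc k) f))
    (hspan : ∀ z : K, ∃ a b : RatFunc k,
      z = algebraMap (RatFunc k) K a + algebraMap (RatFunc k) K b * y)
    (σ : K ≃ₐ[k] K) :
    ∃ a : RatFunc k, σ (algebraMap (RatFunc k) K RatFunc.X) = algebraMap (RatFunc k) K a := by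
  set ι := algebraMap (RatFunc k) K with hι
  have ιinj : Function.Injective ι := ι.injective
  set j := algebraMap k[X] (RatFunc k) with hj
  have jinj : Function.Injective j := IsFractionRing.injective k[X] (RatFunc k)
  have hf0 : f ≠ 0 := hf.ne_zero
  have indep : ∀ a b : RatFunc k, ι a + ι b * y = 0 → a = 0 ∧ b = 0 := by
    intro a b h
    have hb : b = 0 := by
      by_contra hb
      have hb' : ι b ≠ 0 := fun h => hb (ιinj (by simpa using h))
      have : y = ι (-a / b) := by
        rw [map_div₀, map_neg]; field_simp; linear_combination h
      apply sq_ne_algebraMap hf (by omega) (-a / b)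
      apply ιinj
      rw [map_pow, ← this, hy]
    subst hb
    refine ⟨ιinj ?_, rfl⟩
    simpa using h
  set x := ι RatFunc.X with hx
  set u := σ x with hu
  obtain ⟨a, b, hab⟩ := hspan u
  by_cases hb : b = 0
  · exact ⟨a, by rw [hab, hb]; simp⟩
  exfalso
  set w := σ.symm x with hw
  obtain ⟨a', b', hab'⟩ := hspan w
  obtain ⟨r, s, hrs⟩ := quad_rel hy a' b'
  have hrs := hrs w hab'
  let ψ : K → k[X][X] →+* K := fun z => eval₂RingHom (ι.comp j) z
  have hψC : ∀ z p, ψ z (C p) = ι (j p) := fun z p => by simp [ψ]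
  have hψX : ∀ z, ψ z X = z := fun z => by simp [ψ]
  let Q₀ : k[X][X] := C (r.denom * s.denom) * X ^ 2 + C (r.num * s.denom) * X
    + C (s.num * r.denom)
  have hrd := r.denom_ne_zero
  have hsd := s.denom_ne_zero
  have hQdeg : Q₀.natDegree ≤ 2 := natDegree_quadratic_le
  have hQ0 : Q₀ ≠ 0 := by
    intro h
    have : Q₀.coeff 2 = r.denom * s.denom := by
      simp only [Q₀, coeff_add, coeff_C_mul, coeff_X_pow, coeff_X, coeff_C]
      norm_num
    rw [h, coeff_zero] at this
    exact mul_ne_zero hrd hsd this.symm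
  have er : j r.num = r * j r.denom := by
    have h1 : j r.denom ≠ 0 := fun h => hrd (jinj (by simpa using h))
    have h2 : j r.num / j r.denom = r := RatFunc.num_div_denom r
    rw [div_eq_iff h1] at h2
    exact h2
  have es : j s.num = s * j s.denom := by
    have h1 : j s.denom ≠ 0 := fun h => hsd (jinj (by simpa using h))
    have h2 : j s.num / j s.denom = s := RatFunc.num_div_denom s
    rw [div_eq_iff h1] at h2
    exact h2
  have hQw : ψ w Q₀ = 0 := by
    simp only [Q₀, map_add, map_mul, map_pow, hψC, hψX, er, es]
    linear_combination (ι (j r.denom) * ι (j s.denom)) * hrs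
  have hswap : ∀ P : k[X][X], ψ u (Bivariate.swap P) = σ (ψ w P) := by
    intro P
    have : (ψ u).comp ((Bivariate.swap (R := k) : k[X][X] ≃ₐ[k] k[X][X]) : k[X][X] →+* k[X][X])
        = ((σ : K →ₐ[k] K) : K →+* K).comp (ψ w) := by
      have hc : ∀ c : k, ι (j (C c)) = algebraMap k K c := by
        intro c
        rw [IsScalarTower.algebraMap_apply k (RatFunc k) K]
        congr 1
      apply Polynomial.ringHom_ext'
      · apply Polynomial.ringHom_ext'
        · ext c
          simp only [RingHom.comp_apply]
          change ψ u (Bivariate.swap (C (C c))) = σ (ψ w (C (C c)))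
          rw [Bivariate.swap_C_C, hψC, hψC, hc, σ.commutes]
        · change ψ u (Bivariate.swap (C X)) = σ (ψ w (C X))
          rw [Bivariate.swap_X, hψX, hψC, hj, RatFunc.algebraMap_X]
      · change ψ u (Bivariate.swap X) = σ (ψ w X)
        rw [Bivariate.swap_Y, hψC, hψX, hw, hj, RatFunc.algebraMap_X, σ.apply_symm_apply]
    exact congrArg (fun g : k[X][X] →+* K => g P) this
  obtain ⟨P, hPirr, hPdvd, hPu⟩ := exists_irreducible_dvd (ψ u) (Q := Bivariate.swap Q₀)
    (by simpa using hQ0) (by rw [hswap, hQw, map_zero])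
  have hdegX : ∀ i, (P.coeff i).natDegree ≤ 2 := by
    intro i
    have h1 : Bivariate.swap P ∣ Q₀ := by
      have := map_dvd (Bivariate.swap (R := k)) hPdvd
      rwa [Bivariate.swap_swap_apply] at this
    have h2 := (natDegree_le_of_dvd h1 hQ0).trans hQdeg
    rw [natDegree_le_iff_coeff_eq_zero]
    intro n hn
    have h3 := coeff_eq_zero_of_natDegree_lt (p := Bivariate.swap P) (n := n) (by omega)
    rw [← coeff_coeff_swap, h3, coeff_zero]
  have hPdeg0 : P.natDegree ≠ 0 := by
    intro h
    obtain ⟨p, rfl⟩ := natDegree_eq_zero.1 h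
    rw [hψC] at hPu
    have : p = 0 := jinj (ιinj (by simpa using hPu))
    exact hPirr.ne_zero (by simp [this])
  have hPK : Irreducible (P.map j) :=
    ((hPirr.isPrimitive hPdeg0).irreducible_iff_irreducible_map_fraction_map).1 hPirr
  have hPau : aeval u (P.map j) = 0 := by
    rw [aeval_def, eval₂_map]; exact hPu
  obtain ⟨r', s', hrs'⟩ := quad_rel hy a b
  have hrs' := hrs' u hab
  have hdegY : P.natDegree ≤ 2 := by
    let q : (RatFunc k)[X] := X ^ 2 + C r' * X + C s'
    have hq : aeval u q = 0 := by simpa [q] using hrs'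
    have hqdeg : q.natDegree ≤ 2 := by
      have := natDegree_quadratic_le (a := (1 : RatFunc k)) (b := r') (c := s')
      simpa [q] using this
    have hq0 : q ≠ 0 := by
      intro h
      have : q.coeff 2 = 1 := by simp only [q, coeff_add, coeff_C_mul, coeff_X_pow, coeff_X, coeff_C]; norm_num
      rw [h] at this; simp at this
    have h1 := minpoly.dvd _ u hq
    rw [← minpoly.eq_of_irreducible hPK hPau] at h1
    have h2 := natDegree_le_of_dvd ((dvd_mul_right _ _).trans h1) hq0
    rw [natDegree_map_eq_of_injective jinj] at h2
    omega
  set A := P.coeff 2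
  set B := P.coeff 1
  set E := P.coeff 0
  have hPform : P = C A * X ^ 2 + C B * X + C E := by
    have := P.as_sum_range_C_mul_X_pow' (n := 3) (by omega)
    rw [this]; simp [Finset.sum_range_succ, A, B, E]; ring
  have hrel : ι (j A) * u ^ 2 + ι (j B) * u + ι (j E) = 0 := by
    rw [hPform] at hPu
    simpa only [map_add, map_mul, map_pow, hψC, hψX] using hPu
  set D := B ^ 2 - 4 * A * E with hD
  have hDdeg : D.natDegree ≤ 4 := by
    have hA : A.natDegree ≤ 2 := hdegX 2
    have hB : B.natDegree ≤ 2 := hdegX 1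
    have hE : E.natDegree ≤ 2 := hdegX 0
    have : (4 : k[X]) = C 4 := (map_ofNat C 4).symm
    rw [hD, this]
    compute_degree
    omega
  have hsq : (2 * ι (j A) * u + ι (j B)) ^ 2 = ι (j D) := by
    simp only [hD, map_sub, map_mul, map_pow, map_ofNat]
    linear_combination 4 * ι (j A) * hrel
  by_cases hA : A = 0
  · have h1 := indep (j B * a + j E) (j B * b) (by
      rw [hA, hab] at hrel
      simp only [map_add, map_mul, map_zero] at hrel ⊢
      linear_combination hrel)
    have hB : B = 0 := jinj (by simpa [hb] using h1.2)
    have hE : E = 0 := jinj (by simpa [hB] using h1.1)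
    exact hPirr.ne_zero (by rw [hPform, hA, hB, hE]; simp)
  · have hjA : j A ≠ 0 := fun h => hA (jinj (by simpa using h))
    have h1 := indep ((2 * j A * a + j B) ^ 2 + (2 * j A * b) ^ 2 * j f - j D)
      (2 * (2 * j A * a + j B) * (2 * j A * b)) (by
        rw [hab] at hsq
        simp only [map_add, map_mul, map_sub, map_pow, map_ofNat, ← hy] at hsq ⊢
        linear_combination hsq)
    have h2 : 2 * j A * a + j B = 0 := by
      have := h1.2
      simpa [hjA, hb] using this
    have h3 : j D = (2 * j A * b) ^ 2 * j f := by
      have := h1.1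
      rw [h2] at this
      linear_combination -this
    have h4 := dvd_of_sq_mul hf _ h3
    have hD0 : D ≠ 0 := by
      intro h
      rw [h, map_zero] at h3
      have hjf : j f ≠ 0 := fun h => hf0 (jinj (by simpa using h))
      exact (mul_ne_zero (pow_ne_zero 2 (mul_ne_zero (mul_ne_zero two_ne_zero hjA) hb)) hjf) h3.symm
    have := natDegree_le_of_dvd h4 hD0
    omega

/-- Such an automorphism maps the subfield `k(x)` into itself. -/
theorem map_mem_range {K : Type*} [Field K] [CharZero k] [Algebra k K] [Algebra (RatFunc k) K]
    [IsScalarTower k (RatFunc k) K] {f : k[X]} (hf : Squarefree f) (hd : 5 ≤ f.natDegree) {y : K}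
    (hy : y ^ 2 = algebraMap (RatFunc k) K (algebraMap k[X] (RatFunc k) f))
    (hspan : ∀ z : K, ∃ a b : RatFunc k,
      z = algebraMap (RatFunc k) K a + algebraMap (RatFunc k) K b * y)
    (σ : K ≃ₐ[k] K) (r : RatFunc k) :
    ∃ a : RatFunc k, σ (algebraMap (RatFunc k) K r) = algebraMap (RatFunc k) K a := by
  obtain ⟨a, ha⟩ := map_X_mem_range hf hd hy hspan σ
  have hp : ∀ p : k[X], σ (algebraMap (RatFunc k) K (algebraMap k[X] (RatFunc k) p))
      = algebraMap (RatFunc k) K (aeval a p) := by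
    intro p
    rw [← RatFunc.aeval_X_left_eq_algebraMap]
    have h : ∀ c : RatFunc k, algebraMap (RatFunc k) K c = IsScalarTower.toAlgHom k (RatFunc k) K c :=
      fun c => rfl
    rw [h, h, ← aeval_algHom_apply, ← aeval_algHom_apply, ← h, ha]
    exact aeval_algHom_apply (IsScalarTower.toAlgHom k (RatFunc k) K) a p
  refine ⟨aeval a r.num / aeval a r.denom, ?_⟩
  conv_lhs => rw [← RatFunc.num_div_denom r]
  rw [map_div₀, map_div₀, map_div₀, hp, hp]

end Auxiliary

/-! ### The function field, the automorphism group, the reduced automorphism group -/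

section FunctionField

variable {k : Type*} [Field k] (H : HyperellipticCurve k)

/-- The polynomial `T ^ 2 - f(X)` over `k(X)`. -/
noncomputable abbrev equation : (RatFunc k)[X] :=
  X ^ 2 - C (algebraMap k[X] (RatFunc k) H.f)

/-- The function field `K = k(X, Y)`, `Y ^ 2 = f(X)`, of the curve. -/
abbrev FunctionField : Type _ := AdjoinRoot H.equation

theorem five_le_natDegree : 5 ≤ H.f.natDegree := by
  have := H.two_le_g
  have := H.natDegree_f
  omega

instance fact_irreducible : Fact (Irreducible H.equation) :=
  ⟨X_pow_sub_C_irreducible_of_prime Nat.prime_two fun b =>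
    sq_ne_algebraMap H.squarefree_f (by have := H.five_le_natDegree; omega) b⟩

/-- The automorphism group `Aut(K/k)` of the curve. -/
abbrev Aut : Type _ := H.FunctionField ≃ₐ[k] H.FunctionField

/-- The subgroup `Gal(K/k(X))` of `Aut(K/k)`, generated by the hyperelliptic involution:
the automorphisms which fix the subfield `k(X)` pointwise. -/
noncomputable def hyperellipticSubgroup : Subgroup H.Aut :=
  fixingSubgroup H.Aut (Set.range (algebraMap (RatFunc k) H.FunctionField))

theorem mem_hyperellipticSubgroup (σ : H.Aut) : σ ∈ H.hyperellipticSubgroup ↔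
    ∀ r : RatFunc k, σ (algebraMap (RatFunc k) H.FunctionField r) =
      algebraMap (RatFunc k) H.FunctionField r := by
  simp [hyperellipticSubgroup, mem_fixingSubgroup_iff]

theorem exists_eq_add_mul_root (z : H.FunctionField) : ∃ a b : RatFunc k,
    z = algebraMap (RatFunc k) H.FunctionField a +
      algebraMap (RatFunc k) H.FunctionField b * AdjoinRoot.root H.equation := by
  have hm : H.equation.Monic := monic_X_pow_sub_C _ two_ne_zero
  have hn : H.equation.natDegree = 2 := natDegree_X_pow_sub_C
  obtain ⟨p, rfl⟩ := AdjoinRoot.mk_surjective z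
  have h1 : AdjoinRoot.mk H.equation p = AdjoinRoot.mk H.equation (p %ₘ H.equation) := by
    conv_lhs => rw [← modByMonic_add_div p H.equation]
    simp
  have h2 : (p %ₘ H.equation).natDegree < 2 := by
    rw [← hn]
    exact natDegree_modByMonic_lt p hm (fun h => by rw [h] at hn; simp at hn)
  refine ⟨(p %ₘ H.equation).coeff 0, (p %ₘ H.equation).coeff 1, ?_⟩
  rw [h1]
  conv_lhs => rw [(p %ₘ H.equation).as_sum_range_C_mul_X_pow' h2]
  simp [Finset.sum_range_succ, AdjoinRoot.algebraMap_eq]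

theorem root_sq : AdjoinRoot.root H.equation ^ 2 =
    algebraMap (RatFunc k) H.FunctionField (algebraMap k[X] (RatFunc k) H.f) := by
  have h := AdjoinRoot.eval₂_root H.equation
  simp only [equation, eval₂_sub, eval₂_X_pow, eval₂_C] at h
  exact sub_eq_zero.1 h

/-- `k(X)` is stable under `Aut(K/k)`, hence `Gal(K/k(X))` is a normal subgroup. -/
instance normal_hyperellipticSubgroup [CharZero k] : H.hyperellipticSubgroup.Normal := by
  refine ⟨fun τ hτ σ => ?_⟩
  rw [mem_hyperellipticSubgroup] at hτ ⊢
  intro r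
  obtain ⟨a, ha⟩ := map_mem_range H.squarefree_f H.five_le_natDegree H.root_sq
    H.exists_eq_add_mul_root σ⁻¹ r
  rw [AlgEquiv.mul_apply, AlgEquiv.mul_apply, ha, hτ, ← ha, ← AlgEquiv.mul_apply,
    mul_inv_cancel, AlgEquiv.one_apply]

/-- The reduced automorphism group `Aut(K/k) / Gal(K/k(X))`. -/
abbrev ReducedAut [CharZero k] : Type _ := H.Aut ⧸ H.hyperellipticSubgroup

end FunctionField

end HyperellipticCurve

/-! ### Transvections of binary forms

A binary form in `X, Z` is an element of `MvPolynomial (Fin 2) k`; the variable `X` has index `0`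
and the variable `Z` has index `1`. -/

/-- The `r`-transvection `(p, q)^r` of binary forms `p`, `q` of degrees `n`, `m` (`r ≤ n, m`). -/
noncomputable def transvection {k : Type*} [Field k] (n m r : ℕ) (p q : MvPolynomial (Fin 2) k) :
    MvPolynomial (Fin 2) k :=
  MvPolynomial.C (((m - r).factorial * (n - r).factorial : k) / (n.factorial * m.factorial)) *
    ∑ i ∈ Finset.range (r + 1), (-1) ^ i * (r.choose i : MvPolynomial (Fin 2) k) *
      ((MvPolynomial.pderiv 0)^[r - i] ((MvPolynomial.pderiv 1)^[i] p)) *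
      ((MvPolynomial.pderiv 0)^[i] ((MvPolynomial.pderiv 1)^[r - i] q))

namespace HyperellipticCurve

variable {k : Type*} [Field k] (H : HyperellipticCurve k)

/-- The order `d = 2 * g + 2` of the binary form of the curve. -/
def order : ℕ := 2 * H.g + 2

/-- The binary form `F(X, Z) = ∑ aᵢ X ^ i Z ^ (d - i)` of order `d = 2 * g + 2`, where the `aᵢ` are
the coefficients of `f`. -/
noncomputable def form : MvPolynomial (Fin 2) k :=
  ∑ i ∈ Finset.range (H.order + 1),
    MvPolynomial.C (H.f.coeff i) * MvPolynomial.X 0 ^ i * MvPolynomial.X 1 ^ (H.order - i)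

/-- The covariant `J₄ = (F, F)^(d - 2)`, a binary form of order `4`. -/
noncomputable def J₄ : MvPolynomial (Fin 2) k :=
  transvection H.order H.order (H.order - 2) H.form H.form

/-- The invariant `I₄ = (J₄, J₄)^4`, a binary form of order `0`. -/
noncomputable def I₄ : MvPolynomial (Fin 2) k :=
  transvection 4 4 4 H.J₄ H.J₄

end HyperellipticCurve

/-!
Every automorphism `σ` of the curve preserves `k(x)`, hence restricts to an automorphism of it, and
the degree formula for `k(x) / k(σ x)` shows that `σ x = (a x + b) / (c x + d)` (`exists_actsBy`).
As `σ` multiplies `y` by a rational function of `x`, the polynomial obtained from `f` by this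
substitution differs from `f` by a square in `k(x)`; comparing degrees, the square is a constant, so
the binary form `F` is a semi-invariant of the matrix of `σ` (`ActsBy.exists_linearSubst_form`).
Transvections are covariants (`transvection_linearSubst`, by Cayley's `Ω`-process on the tensor
square of the polynomial ring), so the quartic `J₄` is a semi-invariant too.

Suppose `I₄ = (J₄, J₄)⁴ ≠ 0`, and let `M` be the matrix of an automorphism of order three in the
reduced group. Invariance of `I₄` gives `μ² = det M ^ 4` for the multiplier `μ` of `J₄`, and `M ^ 3`
being scalar gives `μ³ = det M ^ 6`, so `μ = det M ^ 2` (`multiplier_eq_det_sq`). In coordinates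
where `M` is diagonal this leaves only the monomial `X₀² X₁²` in `J₄`
(`eq_monomial_of_linearSubst_diagonal`): the roots of `J₄` are the two fixed points of `M`, each
taken twice. A second element of order three must then permute these two points, hence fix both, and
so commutes with the first (`transvection_self_eq_zero_of_semiinvariant`). But `A₄` contains
3-cycles which do not commute. For the full automorphism groups `ℤ/2 × A₄` and `SL₂(𝔽₃)`, two
elements of order three whose commutator is not central have images in the reduced group which do
not commute, as the hyperelliptic involution is central.
-/

open scoped commutatorElement

/-! ### Linear substitutions and the covariance of transvections -/

section BinaryForms

open TensorProduct

variable {k : Type*} [Field k]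

/-- The linear substitution `p ↦ p ∘ M` on polynomials in two variables: it replaces the variable
of index `i` by `∑ j, M i j * X j`. -/
noncomputable def linearSubst (M : Matrix (Fin 2) (Fin 2) k) :
    MvPolynomial (Fin 2) k →ₐ[k] MvPolynomial (Fin 2) k :=
  MvPolynomial.aeval fun i => MvPolynomial.C (M i 0) * MvPolynomial.X 0 +
    MvPolynomial.C (M i 1) * MvPolynomial.X 1

theorem linearSubst_X (M : Matrix (Fin 2) (Fin 2) k) (i : Fin 2) :
    linearSubst M (MvPolynomial.X i) = MvPolynomial.C (M i 0) * MvPolynomial.X 0 +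
      MvPolynomial.C (M i 1) * MvPolynomial.X 1 := by
  simp [linearSubst]

theorem linearSubst_C (M : Matrix (Fin 2) (Fin 2) k) (a : k) :
    linearSubst M (MvPolynomial.C a) = MvPolynomial.C a :=
  (linearSubst M).commutes a

theorem linearSubst_linearSubst (M N : Matrix (Fin 2) (Fin 2) k) (p : MvPolynomial (Fin 2) k) :
    linearSubst N (linearSubst M p) = linearSubst (M * N) p := by
  have : (linearSubst N).comp (linearSubst M) = linearSubst (M * N) := by
    apply MvPolynomial.algHom_ext
    intro i
    simp only [AlgHom.comp_apply, linearSubst_X, map_add, map_mul, linearSubst_C, Matrix.mul_apply,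
      Fin.sum_univ_two]
    ring
  exact congrArg (fun φ : _ →ₐ[k] _ => φ p) this

theorem aeval_linearSubst {A : Type*} [CommRing A] [Algebra k A] (M : Matrix (Fin 2) (Fin 2) k)
    (p : MvPolynomial (Fin 2) k) (u v : A) :
    MvPolynomial.aeval ![u, v] (linearSubst M p) =
      MvPolynomial.aeval ![algebraMap k A (M 0 0) * u + algebraMap k A (M 0 1) * v,
        algebraMap k A (M 1 0) * u + algebraMap k A (M 1 1) * v] p := by
  rw [← AlgHom.comp_apply]
  congr 1
  apply MvPolynomial.algHom_ext
  intro i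
  fin_cases i <;> simp [linearSubst_X]

theorem isHomogeneous_linearSubst (M : Matrix (Fin 2) (Fin 2) k) {p : MvPolynomial (Fin 2) k}
    {n : ℕ} (hp : p.IsHomogeneous n) : (linearSubst M p).IsHomogeneous n := by
  have := hp.aeval (n := 1) (τ := Fin 2) (fun i => MvPolynomial.C (M i 0) * MvPolynomial.X 0 +
    MvPolynomial.C (M i 1) * MvPolynomial.X 1) fun i => by
      refine .add ?_ ?_
      · simpa using (MvPolynomial.isHomogeneous_C _ _).mul (MvPolynomial.isHomogeneous_X _ _)
      · simpa using (MvPolynomial.isHomogeneous_C _ _).mul (MvPolynomial.isHomogeneous_X _ _)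
  rw [one_mul] at this
  exact this

theorem linearSubst_scalar {p : MvPolynomial (Fin 2) k} {n : ℕ} (hp : p.IsHomogeneous n) (s : k) :
    linearSubst (Matrix.scalar (Fin 2) s) p = MvPolynomial.C (s ^ n) * p := by
  conv_lhs => rw [p.as_sum]
  conv_rhs => rw [p.as_sum]
  rw [map_sum, Finset.mul_sum]
  refine Finset.sum_congr rfl fun m hm => ?_
  obtain rfl : m.weight 1 = n := hp (by simpa using hm)
  rw [MvPolynomial.monomial_eq]
  simp [Finsupp.prod_fintype, Finsupp.weight_apply, Finsupp.sum_fintype, Fin.prod_univ_two,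
    Fin.sum_univ_two, linearSubst_X]
  ring

/-- The chain rule for a linear substitution. -/
theorem pderiv_linearSubst (M : Matrix (Fin 2) (Fin 2) k) (i : Fin 2)
    (p : MvPolynomial (Fin 2) k) :
    MvPolynomial.pderiv i (linearSubst M p) =
      MvPolynomial.C (M 0 i) * linearSubst M (MvPolynomial.pderiv 0 p) +
        MvPolynomial.C (M 1 i) * linearSubst M (MvPolynomial.pderiv 1 p) := by
  induction p using MvPolynomial.induction_on with
  | C a => simp
  | add p q hp hq => simp only [map_add, hp, hq]; ring
  | mul_X p j hp =>
    simp only [map_mul, Derivation.leibniz, smul_eq_mul, map_add, hp]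
    fin_cases j <;> fin_cases i <;> simp [linearSubst_X, Derivation.leibniz] <;> ring

theorem pderiv_pderiv_comm (i j : Fin 2) (p : MvPolynomial (Fin 2) k) :
    MvPolynomial.pderiv i (MvPolynomial.pderiv j p) =
      MvPolynomial.pderiv j (MvPolynomial.pderiv i p) := by
  have : ⁅(MvPolynomial.pderiv i : Derivation k (MvPolynomial (Fin 2) k) (MvPolynomial (Fin 2) k)),
      (MvPolynomial.pderiv j : Derivation k (MvPolynomial (Fin 2) k) (MvPolynomial (Fin 2) k))⁆
        = 0 := by
    apply MvPolynomial.derivation_ext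
    intro l
    rw [Derivation.commutator_apply]
    fin_cases i <;> fin_cases j <;> fin_cases l <;> simp
  have := congrArg (fun D : Derivation k _ _ => D p) this
  simpa [Derivation.commutator_apply, sub_eq_zero] using this

/-- The partial derivative as a `k`-linear endomorphism. -/
noncomputable abbrev pderivLin (i : Fin 2) : Module.End k (MvPolynomial (Fin 2) k) :=
  (MvPolynomial.pderiv i : Derivation k (MvPolynomial (Fin 2) k) _).toLinearMap

theorem commute_pderivLin (i j : Fin 2) :
    Commute (pderivLin (k := k) i) (pderivLin j) :=
  LinearMap.ext fun p => pderiv_pderiv_comm i j p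

/-- Cayley's `Ω`-process `∂₀ ⊗ ∂₁ - ∂₁ ⊗ ∂₀`, acting on pairs of polynomials, that is, on the tensor
square of the polynomial ring. -/
noncomputable def cayleyOmega :
    Module.End k (MvPolynomial (Fin 2) k ⊗[k] MvPolynomial (Fin 2) k) :=
  TensorProduct.map (pderivLin 0) (pderivLin 1) - TensorProduct.map (pderivLin 1) (pderivLin 0)

/-- The `r`-th transvection is, up to its numerical factor, the `r`-th power of the `Ω`-process
followed by multiplication. -/
theorem transvection_eq_cayleyOmega (n m r : ℕ) (p q : MvPolynomial (Fin 2) k) :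
    transvection n m r p q =
      MvPolynomial.C (((m - r).factorial * (n - r).factorial : k) / (n.factorial * m.factorial)) *
        LinearMap.mul' k _ ((cayleyOmega ^ r) (p ⊗ₜ q)) := by
  have hc : Commute ((-1 : k) • TensorProduct.map (pderivLin (k := k) 1) (pderivLin 0))
      (TensorProduct.map (pderivLin 0) (pderivLin 1)) := by
    refine Commute.smul_left ?_ _
    change _ * _ = _ * _
    rw [← TensorProduct.map_mul, ← TensorProduct.map_mul, (commute_pderivLin 1 0).eq,
      (commute_pderivLin 0 1).eq]
  have hΩ : cayleyOmega = (-1 : k) • TensorProduct.map (pderivLin (k := k) 1) (pderivLin 0) +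
      TensorProduct.map (pderivLin 0) (pderivLin 1) :=
    LinearMap.ext fun t => by simp [cayleyOmega, sub_eq_neg_add]
  rw [transvection, hΩ, hc.add_pow]
  congr 1
  rw [LinearMap.sum_apply, map_sum]
  refine Finset.sum_congr rfl fun i _ => ?_
  rw [_root_.smul_pow, ← map_natCast (algebraMap k (Module.End k _)), ← Algebra.commutes,
    smul_mul_assoc, TensorProduct.map_pow, TensorProduct.map_pow, ← TensorProduct.map_mul,
    ← ((commute_pderivLin 0 1).pow_pow _ _).eq, Module.End.mul_apply,
    Module.algebraMap_end_apply, LinearMap.smul_apply, TensorProduct.map_tmul, map_smul, map_smul,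
    LinearMap.mul'_apply, Module.End.mul_apply, Module.End.mul_apply, Module.End.pow_apply,
    Module.End.pow_apply, Module.End.pow_apply, Module.End.pow_apply]
  simp only [MvPolynomial.smul_eq_C_mul, map_natCast, map_pow, map_neg, map_one]
  simp only [Derivation.coeFn_coe]
  ring

/-- A linear substitution intertwines the `Ω`-process with its multiple by the determinant. -/
theorem cayleyOmega_pow_linearSubst (M : Matrix (Fin 2) (Fin 2) k) (r : ℕ)
    (t : MvPolynomial (Fin 2) k ⊗[k] MvPolynomial (Fin 2) k) :
    (cayleyOmega ^ r) (TensorProduct.map (linearSubst M).toLinearMap (linearSubst M).toLinearMap t)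
      = M.det ^ r • TensorProduct.map (linearSubst M).toLinearMap (linearSubst M).toLinearMap
        ((cayleyOmega ^ r) t) := by
  have base : ∀ t, cayleyOmega (TensorProduct.map (linearSubst M).toLinearMap
      (linearSubst M).toLinearMap t) = M.det • TensorProduct.map (linearSubst M).toLinearMap
        (linearSubst M).toLinearMap (cayleyOmega t) := by
    intro t
    induction t using TensorProduct.induction_on with
    | zero => simp
    | add s t hs ht => simp only [map_add, hs, ht, smul_add]
    | tmul p q =>
      simp only [cayleyOmega, LinearMap.sub_apply, TensorProduct.map_tmul, Derivation.coeFn_coe,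
        AlgHom.toLinearMap_apply, pderiv_linearSubst, ← MvPolynomial.smul_eq_C_mul, map_sub,
        TensorProduct.add_tmul, TensorProduct.tmul_add, TensorProduct.smul_tmul_smul,
        Matrix.det_fin_two]
      module
  induction r with
  | zero => simp
  | succ r ih => rw [pow_succ', Module.End.mul_apply, ih, map_smul, base, smul_smul, pow_succ]; rfl

/-- Transvections are covariants: they commute with linear substitutions up to a power of the
determinant. -/
theorem transvection_linearSubst (M : Matrix (Fin 2) (Fin 2) k) (n m r : ℕ)
    (p q : MvPolynomial (Fin 2) k) :
    transvection n m r (linearSubst M p) (linearSubst M q) =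
      MvPolynomial.C (M.det ^ r) * linearSubst M (transvection n m r p q) := by
  have h := cayleyOmega_pow_linearSubst M r (p ⊗ₜ q)
  have hmul : ∀ t, LinearMap.mul' k (MvPolynomial (Fin 2) k) (TensorProduct.map
      (linearSubst M).toLinearMap (linearSubst M).toLinearMap t) =
        linearSubst M (LinearMap.mul' k _ t) := by
    intro t
    induction t using TensorProduct.induction_on with
    | zero => simp
    | add s t hs ht => simp only [map_add, hs, ht]
    | tmul p q => simp
  rw [TensorProduct.map_tmul] at h
  simp only [AlgHom.toLinearMap_apply] at h
  rw [transvection_eq_cayleyOmega, transvection_eq_cayleyOmega, h, map_smul, hmul, map_mul,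
    linearSubst_C, MvPolynomial.smul_eq_C_mul]
  ring

theorem transvection_C_mul (n m r : ℕ) (a b : k) (p q : MvPolynomial (Fin 2) k) :
    transvection n m r (MvPolynomial.C a * p) (MvPolynomial.C b * q) =
      MvPolynomial.C (a * b) * transvection n m r p q := by
  rw [transvection_eq_cayleyOmega, transvection_eq_cayleyOmega, ← MvPolynomial.smul_eq_C_mul p,
    ← MvPolynomial.smul_eq_C_mul q, TensorProduct.smul_tmul_smul, map_smul, map_smul,
    MvPolynomial.smul_eq_C_mul]
  ring

theorem isHomogeneous_iterate_pderiv (i : Fin 2) (a : ℕ) {n : ℕ} {p : MvPolynomial (Fin 2) k}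
    (hp : p.IsHomogeneous n) : ((MvPolynomial.pderiv i)^[a] p).IsHomogeneous (n - a) := by
  induction a with
  | zero => simpa
  | succ a ih => rw [Function.iterate_succ_apply', ← Nat.sub_sub]; exact ih.pderiv

theorem isHomogeneous_transvection {n m r : ℕ} {p q : MvPolynomial (Fin 2) k}
    (hp : p.IsHomogeneous n) (hq : q.IsHomogeneous m) :
    (transvection n m r p q).IsHomogeneous (n - r + (m - r)) := by
  rw [transvection]
  refine (MvPolynomial.IsHomogeneous.sum _ _ _ fun i hi => ?_).C_mul _
  have hi : i ≤ r := by simpa [Nat.lt_succ_iff] using hi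
  have h1 := isHomogeneous_iterate_pderiv 0 (r - i) (isHomogeneous_iterate_pderiv 1 i hp)
  have h2 := isHomogeneous_iterate_pderiv 0 i (isHomogeneous_iterate_pderiv 1 (r - i) hq)
  rw [Nat.sub_sub, Nat.add_sub_cancel' hi] at h1
  rw [Nat.sub_sub, Nat.sub_add_cancel hi] at h2
  refine .mul ?_ h2
  have : ((-1) ^ i * (r.choose i : MvPolynomial (Fin 2) k)) =
      MvPolynomial.C ((-1) ^ i * (r.choose i : k)) := by simp
  rw [this]
  exact h1.C_mul _

end BinaryForms

/-! ### Quartics with a semi-invariance of order three -/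

section Quartics

variable {k : Type*} [Field k]

theorem linearSubst_diagonal_monomial (u v a : k) (m : Fin 2 →₀ ℕ) :
    linearSubst (Matrix.diagonal ![u, v]) (MvPolynomial.monomial m a) =
      MvPolynomial.monomial m (u ^ m 0 * v ^ m 1 * a) := by
  rw [MvPolynomial.monomial_eq, MvPolynomial.monomial_eq]
  simp [Finsupp.prod_fintype, Fin.prod_univ_two, linearSubst_X]
  ring

theorem coeff_linearSubst_diagonal (u v : k) (p : MvPolynomial (Fin 2) k) (m : Fin 2 →₀ ℕ) :
    (linearSubst (Matrix.diagonal ![u, v]) p).coeff m = u ^ m 0 * v ^ m 1 * p.coeff m := by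
  induction p using MvPolynomial.induction_on' with
  | monomial n a =>
    rw [linearSubst_diagonal_monomial, MvPolynomial.coeff_monomial, MvPolynomial.coeff_monomial]
    split_ifs with h
    · rw [h]
    · simp
  | add p q hp hq => rw [map_add, MvPolynomial.coeff_add, hp, hq, MvPolynomial.coeff_add, mul_add]

/-- A `2 × 2` matrix which is not scalar but whose cube is scalar satisfies `tr² = det`, that is,
its eigenvalues `u`, `v` satisfy `u² + u v + v² = 0`. -/
theorem trace_sq_eq_det_of_pow_three {M : Matrix (Fin 2) (Fin 2) k} {s : k}
    (h3 : M ^ 3 = Matrix.scalar (Fin 2) s) (hM : ∀ a, M ≠ Matrix.scalar (Fin 2) a) :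
    M.trace ^ 2 = M.det := by
  by_contra hne
  have hne : M.trace ^ 2 - M.det ≠ 0 := sub_ne_zero.2 hne
  have e : ∀ i j, (M ^ 3) i j = Matrix.scalar (Fin 2) s i j := fun i j => by rw [h3]
  simp only [pow_succ, pow_zero, one_mul, Matrix.mul_apply, Fin.sum_univ_two] at e
  have e00 := e 0 0
  have e01 := e 0 1
  have e10 := e 1 0
  have e11 := e 1 1
  simp at e00 e01 e10 e11
  rw [Matrix.trace_fin_two, Matrix.det_fin_two] at hne
  refine hM (M 0 0) ?_
  have h01 : M 0 1 = 0 := mul_left_cancel₀ hne (by linear_combination e01)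
  have h10 : M 1 0 = 0 := mul_left_cancel₀ hne (by linear_combination e10)
  have h11 : M 1 1 = M 0 0 := mul_left_cancel₀ hne (by linear_combination e11 - e00)
  ext i j
  fin_cases i <;> fin_cases j <;> simp [h01, h10, h11]

/-- A matrix of order three in `PGL₂` is diagonalizable, and the quotient of its eigenvalues is a
primitive cube root of unity. -/
theorem exists_diagonalization_of_pow_three [IsAlgClosed k] [CharZero k]
    {M : Matrix (Fin 2) (Fin 2) k} {s : k} (hdet : M.det ≠ 0)
    (h3 : M ^ 3 = Matrix.scalar (Fin 2) s) (hM : ∀ a, M ≠ Matrix.scalar (Fin 2) a) :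
    ∃ (P : Matrix (Fin 2) (Fin 2) k) (u v : k), P.det ≠ 0 ∧ u * v ≠ 0 ∧
      u ^ 2 + u * v + v ^ 2 = 0 ∧ M * P = P * Matrix.diagonal ![u, v] := by
  have htr := trace_sq_eq_det_of_pow_three h3 hM
  obtain ⟨u, hu⟩ := IsAlgClosed.exists_root (X ^ 2 - C M.trace * X + C M.det)
    (by
      have : (X ^ 2 - C M.trace * X + C M.det).natDegree = 2 := by compute_degree!
      intro h
      rw [natDegree_eq_of_degree_eq_some h] at this
      exact absurd this (by norm_num))
  simp only [IsRoot.def, eval_add, eval_sub, eval_pow, eval_X, eval_mul, eval_C] at hu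
  obtain ⟨v, hv⟩ : ∃ v, v = M.trace - u := ⟨_, rfl⟩
  rw [Matrix.trace_fin_two, Matrix.det_fin_two] at *
  have huv : u * v = M 0 0 * M 1 1 - M 0 1 * M 1 0 := by rw [hv]; linear_combination -hu
  have hadd : u + v = M 0 0 + M 1 1 := by rw [hv]; ring
  have hq : u ^ 2 + u * v + v ^ 2 = 0 := by
    linear_combination htr + (u + v + M 0 0 + M 1 1) * hadd - huv
  have huv0 : u * v ≠ 0 := by rwa [huv]
  have hne : u - v ≠ 0 := by
    intro h
    obtain rfl : u = v := sub_eq_zero.1 h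
    apply huv0
    have : (3 : k) * (u * u) = 0 := by linear_combination hq
    exact (mul_eq_zero.1 this).resolve_left (by norm_num)
  by_cases hb : M 0 1 = 0
  · by_cases hc : M 1 0 = 0
    · refine ⟨1, M 0 0, M 1 1, by simp, by simpa [hb] using hdet, ?_, ?_⟩
      · rw [hb] at htr; linear_combination htr
      · rw [mul_one, one_mul]
        ext i j
        fin_cases i <;> fin_cases j <;> simp [hb, hc]
    · refine ⟨!![u - M 1 1, v - M 1 1; M 1 0, M 1 0], u, v, ?_, huv0, hq, ?_⟩
      · rw [Matrix.det_fin_two]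
        have : (u - M 1 1) * M 1 0 - (v - M 1 1) * M 1 0 = (u - v) * M 1 0 := by ring
        simpa [this] using ⟨hne, hc⟩
      · ext i j
        fin_cases i <;> fin_cases j <;> simp [Matrix.mul_apply, Fin.sum_univ_two]
        · linear_combination huv - u * hadd
        · linear_combination huv - v * hadd
        · ring
        · ring
  · refine ⟨!![M 0 1, M 0 1; u - M 0 0, v - M 0 0], u, v, ?_, huv0, hq, ?_⟩
    · rw [Matrix.det_fin_two]
      have : M 0 1 * (v - M 0 0) - M 0 1 * (u - M 0 0) = -(M 0 1 * (u - v)) := by ring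
      simpa [this] using ⟨hb, hne⟩
    · ext i j
      fin_cases i <;> fin_cases j <;> simp [Matrix.mul_apply, Fin.sum_univ_two]
      · ring
      · ring
      · linear_combination huv - u * hadd
      · linear_combination huv - v * hadd

/-- If a quartic `J` with `(J, J)⁴ ≠ 0` is a semi-invariant of an element of order three of `PGL₂`,
then its multiplier is the square of the determinant: the invariance of `(J, J)⁴` forces the
multiplier to be `± det²`, and the cube of this sign is `1`. -/
theorem multiplier_eq_det_sq {J : MvPolynomial (Fin 2) k} (hJ : J.IsHomogeneous 4)
    (hI : transvection 4 4 4 J J ≠ 0) {M : Matrix (Fin 2) (Fin 2) k} {s μ : k} (hdet : M.det ≠ 0)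
    (h3 : M ^ 3 = Matrix.scalar (Fin 2) s) (hμ : linearSubst M J = MvPolynomial.C μ * J) :
    μ = M.det ^ 2 := by
  have hJ0 : J ≠ 0 := by
    rintro rfl
    exact hI (by simpa using transvection_C_mul 4 4 4 (0 : k) 0 0 0)
  have hT : (transvection 4 4 4 J J).IsHomogeneous 0 := isHomogeneous_transvection hJ hJ
  obtain ⟨c, hc⟩ : ∃ c, transvection 4 4 4 J J = MvPolynomial.C c :=
    ⟨_, MvPolynomial.totalDegree_eq_zero_iff_eq_C.1 (Nat.le_zero.1 hT.totalDegree_le)⟩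
  have h2 : μ ^ 2 = M.det ^ 4 := by
    have h := transvection_linearSubst M 4 4 4 J J
    rw [hμ, transvection_C_mul, hc, linearSubst_C, ← hc] at h
    have := MvPolynomial.C_injective _ _ (mul_right_cancel₀ hI h)
    rw [← this]; ring
  have h6 : μ ^ 3 = M.det ^ 6 := by
    have h := linearSubst_scalar hJ s
    rw [← h3, pow_succ, pow_two, ← linearSubst_linearSubst, ← linearSubst_linearSubst, hμ, map_mul,
      linearSubst_C, hμ, map_mul, map_mul, linearSubst_C, hμ, ← mul_assoc, ← mul_assoc, ← map_mul,
      ← map_mul] at h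
    have h4 := MvPolynomial.C_injective _ _ (mul_right_cancel₀ hJ0 h)
    have hs : M.det ^ 3 = s ^ 2 := by
      rw [← Matrix.det_pow, h3]; simp
    linear_combination h4 - (M.det ^ 3 + s ^ 2) * hs
  have h4 : M.det ^ 4 ≠ 0 := pow_ne_zero _ hdet
  refine mul_right_cancel₀ h4 ?_
  linear_combination h6 - μ * h2

/-- An invariant quartic of `diag(u, v)`, with `u / v` a primitive cube root of unity, is a multiple
of `X₀² X₁²`. -/
theorem eq_monomial_of_linearSubst_diagonal {J : MvPolynomial (Fin 2) k} (hJ : J.IsHomogeneous 4)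
    {u v : k} (huv : u * v ≠ 0) (hq : u ^ 2 + u * v + v ^ 2 = 0) (hne : u ≠ v)
    (h : linearSubst (Matrix.diagonal ![u, v]) J = MvPolynomial.C ((u * v) ^ 2) * J) :
    ∃ c, J = MvPolynomial.C c * MvPolynomial.X 0 ^ 2 * MvPolynomial.X 1 ^ 2 := by
  have hu : u ≠ 0 := left_ne_zero_of_mul huv
  have hv : v ≠ 0 := right_ne_zero_of_mul huv
  set m₀ : Fin 2 →₀ ℕ := Finsupp.single 0 2 + Finsupp.single 1 2 with hm₀
  have key : ∀ m, J.coeff m ≠ 0 → m = m₀ := by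
    intro m hm
    have hw : m 0 + m 1 = 4 := by
      have := hJ hm
      simpa [Finsupp.weight_apply, Finsupp.sum_fintype, Fin.sum_univ_two] using this
    have hc := congrArg (MvPolynomial.coeff m) h
    rw [coeff_linearSubst_diagonal, MvPolynomial.coeff_C_mul] at hc
    have hc := mul_right_cancel₀ hm hc
    have hsq : u ^ 2 ≠ v ^ 2 := by
      intro e
      have h1 : (u - v) * (u + v) = 0 := by linear_combination e
      have h2 : u + v = 0 := (mul_eq_zero.1 h1).resolve_left (sub_ne_zero.2 hne)
      exact huv (by linear_combination (u + v) * h2 - hq)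
    have h0 : m 0 = 2 := by
      obtain ⟨i, hi⟩ : ∃ i, m 0 = i := ⟨_, rfl⟩
      obtain ⟨j, hj⟩ : ∃ j, m 1 = j := ⟨_, rfl⟩
      rw [hi, hj] at hw hc
      rw [hi]
      have : i ≤ 4 := by omega
      obtain rfl : j = 4 - i := by omega
      interval_cases i
      · exact absurd (mul_left_cancel₀ (pow_ne_zero 2 hv)
          (by linear_combination -hc)) hsq
      · exact absurd (mul_left_cancel₀ (mul_ne_zero huv hv) (by linear_combination -hc)) hne
      · rfl
      · exact absurd (mul_left_cancel₀ (mul_ne_zero huv hu) (by linear_combination hc)) hne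
      · exact absurd (mul_left_cancel₀ (pow_ne_zero 2 hu) (by linear_combination hc)) hsq
    ext i
    fin_cases i
    · simpa [hm₀] using h0
    · simp [hm₀]; omega
  refine ⟨J.coeff m₀, ?_⟩
  have hmon : MvPolynomial.C (J.coeff m₀) * MvPolynomial.X 0 ^ 2 * MvPolynomial.X 1 ^ 2 =
      MvPolynomial.monomial m₀ (J.coeff m₀) := by
    rw [MvPolynomial.monomial_eq]
    simp [hm₀, Finsupp.prod_fintype, Fin.prod_univ_two, mul_assoc]
  rw [hmon]
  ext m
  rw [MvPolynomial.coeff_monomial]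
  split_ifs with hm
  · rw [hm]
  · by_contra h0
    exact hm (key m h0).symm

/-- A linear substitution which preserves `X₀² X₁²` up to a factor permutes the two lines
`X₀ = 0` and `X₁ = 0`. -/
theorem diagonal_or_antidiagonal {N : Matrix (Fin 2) (Fin 2) k} (hdet : N.det ≠ 0) {c ν : k}
    (hc : c ≠ 0) (h : linearSubst N (MvPolynomial.C c * MvPolynomial.X 0 ^ 2 * MvPolynomial.X 1 ^ 2)
      = MvPolynomial.C ν * (MvPolynomial.C c * MvPolynomial.X 0 ^ 2 * MvPolynomial.X 1 ^ 2)) :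
    (N 0 1 = 0 ∧ N 1 0 = 0) ∨ (N 0 0 = 0 ∧ N 1 1 = 0) := by
  have h10 := congrArg (MvPolynomial.aeval ![(1 : k), 0]) h
  have h01 := congrArg (MvPolynomial.aeval ![(0 : k), 1]) h
  rw [aeval_linearSubst] at h10 h01
  simp [hc] at h10 h01
  rw [Matrix.det_fin_two] at hdet
  rcases h10 with h1 | h1 <;> rcases h01 with h2 | h2 <;> simp_all

/-- If a binary quartic `J` is a semi-invariant of two elements of `PGL₂` of order dividing three
which do not commute, then `(J, J)⁴ = 0`. -/
theorem transvection_self_eq_zero_of_semiinvariant [IsAlgClosed k] [CharZero k]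
    {J : MvPolynomial (Fin 2) k} (hJ : J.IsHomogeneous 4) {M N : Matrix (Fin 2) (Fin 2) k}
    {s t μ ν : k} (hMdet : M.det ≠ 0) (hNdet : N.det ≠ 0)
    (hM3 : M ^ 3 = Matrix.scalar (Fin 2) s) (hN3 : N ^ 3 = Matrix.scalar (Fin 2) t)
    (hMN : M * N ≠ N * M) (hμ : linearSubst M J = MvPolynomial.C μ * J)
    (hν : linearSubst N J = MvPolynomial.C ν * J) : transvection 4 4 4 J J = 0 := by
  by_contra hI
  have hM : ∀ a, M ≠ Matrix.scalar (Fin 2) a := by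
    rintro a rfl
    exact hMN (Matrix.scalar_commute a (fun _ => Commute.all _ _) N).eq
  obtain ⟨P, u, v, hP, huv, hq, hD⟩ := exists_diagonalization_of_pow_three hMdet hM3 hM
  have hPu : IsUnit P.det := isUnit_iff_ne_zero.2 hP
  have hM' : M = P * Matrix.diagonal ![u, v] * P⁻¹ := by
    rw [← hD, Matrix.mul_nonsing_inv_cancel_right _ _ hPu]
  have hdetM : M.det = u * v := by
    have := congrArg Matrix.det hD
    rw [Matrix.det_mul, Matrix.det_mul, mul_comm] at this
    have := mul_left_cancel₀ hP this
    simpa [Fin.prod_univ_two] using this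
  have hne : u ≠ v := by
    rintro rfl
    apply hMN
    have : M = Matrix.scalar (Fin 2) u := by
      have hd : Matrix.diagonal ![u, u] = Matrix.scalar (Fin 2) u := by
        ext i j; fin_cases i <;> fin_cases j <;> simp
      rw [hM', hd, ← (Matrix.scalar_commute u (fun _ => Commute.all _ _) P).eq, mul_assoc,
        Matrix.mul_nonsing_inv _ hPu, mul_one]
    exact absurd this (hM u)
  set N' := P⁻¹ * N * P with hN'
  have hPN : N * P = P * N' := by
    rw [hN', mul_assoc, Matrix.mul_nonsing_inv_cancel_left _ _ hPu]
  obtain ⟨c, hc⟩ := eq_monomial_of_linearSubst_diagonal (isHomogeneous_linearSubst P hJ) huv hq hne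
    (by
      rw [linearSubst_linearSubst, ← hD, ← linearSubst_linearSubst, hμ, map_mul, linearSubst_C,
        multiplier_eq_det_sq hJ hI hMdet hM3 hμ, hdetM])
  have hc0 : c ≠ 0 := by
    rintro rfl
    apply hI
    have h0 := congrArg (linearSubst P⁻¹) hc
    rw [linearSubst_linearSubst, Matrix.mul_nonsing_inv _ hPu] at h0
    have h1 := linearSubst_scalar hJ 1
    rw [map_one] at h1
    rw [h1] at h0
    have hJ0 : J = 0 := by simpa using h0
    rw [hJ0]
    simpa using transvection_C_mul 4 4 4 (0 : k) 0 0 0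
  have hN'det : N'.det ≠ 0 := by
    rw [hN', Matrix.det_mul, Matrix.det_mul]
    exact mul_ne_zero (mul_ne_zero (by rw [Matrix.det_nonsing_inv]; simpa using hP) hNdet) hP
  rcases diagonal_or_antidiagonal hN'det hc0 (ν := ν) (by
      rw [← hc, linearSubst_linearSubst, ← hPN, ← linearSubst_linearSubst, hν, map_mul,
        linearSubst_C]) with ⟨h1, h2⟩ | ⟨h1, h2⟩
  · apply hMN
    have hdiag : N' = Matrix.diagonal ![N' 0 0, N' 1 1] := by
      ext i j; fin_cases i <;> fin_cases j <;> simp [h1, h2]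
    have hcomm : Matrix.diagonal ![u, v] * N' = N' * Matrix.diagonal ![u, v] := by
      rw [hdiag, Matrix.diagonal_mul_diagonal, Matrix.diagonal_mul_diagonal]
      congr 1; funext i; exact mul_comm _ _
    have hN'' : N = P * N' * P⁻¹ := by
      rw [← hPN, Matrix.mul_nonsing_inv_cancel_right _ _ hPu]
    have hcancel : ∀ A B : Matrix (Fin 2) (Fin 2) k,
        P * A * P⁻¹ * (P * B * P⁻¹) = P * (A * B) * P⁻¹ := by
      intro A B
      rw [mul_assoc P B, ← mul_assoc, Matrix.nonsing_inv_mul_cancel_right _ _ hPu]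
      simp only [mul_assoc]
    rw [hM', hN'', hcancel, hcancel, hcomm]
  · -- The square of an antidiagonal matrix is scalar, hence so would be the matrix itself.
    have hcube : N' ^ 3 = Matrix.scalar (Fin 2) t := by
      have : P * N' ^ 3 = P * Matrix.scalar (Fin 2) t := by
        rw [← (Matrix.scalar_commute t (fun _ => Commute.all _ _) P).eq, ← hN3]
        exact SemiconjBy.pow_right (show SemiconjBy P N' N from hPN.symm) 3
      have := congrArg (P⁻¹ * ·) this
      simpa only [Matrix.nonsing_inv_mul_cancel_left _ _ hPu] using this
    have e01 : (N' ^ 3) 0 1 = Matrix.scalar (Fin 2) t 0 1 := by rw [hcube]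
    simp [pow_succ, Matrix.mul_apply, Fin.sum_univ_two, h1, h2] at e01
    rw [Matrix.det_fin_two, h1, h2] at hN'det
    rcases e01 with e | e <;> simp_all

end Quartics

/-! ### The action of the automorphisms on the function field -/

namespace HyperellipticCurve

section Moebius

variable {k : Type*} [Field k] (H : HyperellipticCurve k)

/-- The coordinate function `x` of the curve. -/
noncomputable abbrev xCoord : H.FunctionField :=
  algebraMap (RatFunc k) H.FunctionField RatFunc.X

theorem algebraMap_ratFunc_algebraMap (p : k[X]) :
    algebraMap (RatFunc k) H.FunctionField (algebraMap k[X] (RatFunc k) p) =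
      aeval H.xCoord p := by
  rw [← RatFunc.aeval_X_left_eq_algebraMap]
  exact (aeval_algHom_apply (IsScalarTower.toAlgHom k (RatFunc k) H.FunctionField) RatFunc.X p).symm

theorem aeval_xCoord_injective : Function.Injective (aeval (R := k) H.xCoord) := fun p q h => by
  rw [← algebraMap_ratFunc_algebraMap, ← algebraMap_ratFunc_algebraMap] at h
  exact IsFractionRing.injective k[X] (RatFunc k)
    ((algebraMap (RatFunc k) H.FunctionField).injective h)

theorem eq_zero_of_linear_xCoord {a b : k} (h : algebraMap k H.FunctionField a * H.xCoord +
    algebraMap k H.FunctionField b = 0) : a = 0 ∧ b = 0 := by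
  have h0 : C a * X + C b = 0 := H.aeval_xCoord_injective (by simpa using h)
  constructor
  · simpa using congrArg (coeff · 1) h0
  · simpa using congrArg (coeff · 0) h0

theorem algebraMap_add_mul_root_eq_zero {a b : RatFunc k}
    (h : algebraMap (RatFunc k) H.FunctionField a +
      algebraMap (RatFunc k) H.FunctionField b * AdjoinRoot.root H.equation = 0) :
    a = 0 ∧ b = 0 := by
  have ιinj := (algebraMap (RatFunc k) H.FunctionField).injective
  have hb : b = 0 := by
    by_contra hb
    have hb' : algebraMap (RatFunc k) H.FunctionField b ≠ 0 := fun h => hb (ιinj (by simpa using h))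
    have : AdjoinRoot.root H.equation = algebraMap (RatFunc k) H.FunctionField (-a / b) := by
      rw [map_div₀, map_neg]; field_simp; linear_combination h
    apply sq_ne_algebraMap H.squarefree_f (by have := H.five_le_natDegree; omega) (-a / b)
    apply ιinj
    rw [map_pow, ← this, H.root_sq]
  subst hb
  exact ⟨ιinj (by simpa using h), rfl⟩

/-- An automorphism which fixes `x` fixes `k(x)`. -/
theorem mem_hyperellipticSubgroup_of_xCoord {σ : H.Aut} (h : σ H.xCoord = H.xCoord) :
    σ ∈ H.hyperellipticSubgroup := by
  rw [mem_hyperellipticSubgroup]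
  have hp : ∀ p : k[X], σ (aeval H.xCoord p) = aeval H.xCoord p := fun p => by
    conv_rhs => rw [← h]
    exact (aeval_algHom_apply σ H.xCoord p).symm
  intro r
  rw [← RatFunc.num_div_denom r, map_div₀, map_div₀, algebraMap_ratFunc_algebraMap,
    algebraMap_ratFunc_algebraMap, hp, hp]

/-- The matrix `M` describes the action of `σ` on `x`: `σ x = (M₀₀ x + M₀₁) / (M₁₀ x + M₁₁)`. -/
structure ActsBy (M : Matrix (Fin 2) (Fin 2) k) (σ : H.Aut) : Prop where
  denom_ne_zero : algebraMap k H.FunctionField (M 1 0) * H.xCoord +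
    algebraMap k H.FunctionField (M 1 1) ≠ 0
  denom_mul : (algebraMap k H.FunctionField (M 1 0) * H.xCoord +
    algebraMap k H.FunctionField (M 1 1)) * σ H.xCoord =
      algebraMap k H.FunctionField (M 0 0) * H.xCoord + algebraMap k H.FunctionField (M 0 1)

variable {H}

/-- Composition of automorphisms corresponds to the product of matrices in the opposite order. -/
theorem ActsBy.mul {M N : Matrix (Fin 2) (Fin 2) k} {σ τ : H.Aut} (hσ : H.ActsBy M σ)
    (hτ : H.ActsBy N τ) : H.ActsBy (N * M) (σ * τ) := by
  have h1 := congrArg σ hτ.denom_mul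
  have h2 := hσ.denom_mul
  have h3 : σ (algebraMap k H.FunctionField (N 1 0) * H.xCoord +
    algebraMap k H.FunctionField (N 1 1)) ≠ 0 := by
      rw [Ne, map_eq_zero_iff σ σ.injective]; exact hτ.denom_ne_zero
  simp only [map_mul, map_add, AlgEquiv.commutes] at h1 h3
  have e : algebraMap k H.FunctionField ((N * M) 1 0) * H.xCoord +
      algebraMap k H.FunctionField ((N * M) 1 1) =
      (algebraMap k H.FunctionField (M 1 0) * H.xCoord + algebraMap k H.FunctionField (M 1 1)) *
      (algebraMap k H.FunctionField (N 1 0) * σ H.xCoord +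
        algebraMap k H.FunctionField (N 1 1)) := by
    simp only [Matrix.mul_apply, Fin.sum_univ_two, map_add, map_mul]
    linear_combination -algebraMap k H.FunctionField (N 1 0) * h2
  refine ⟨?_, ?_⟩
  · rw [e]
    exact mul_ne_zero hσ.denom_ne_zero h3
  · rw [e, AlgEquiv.mul_apply]
    simp only [Matrix.mul_apply, Fin.sum_univ_two, map_add, map_mul]
    linear_combination (algebraMap k H.FunctionField (M 1 0) * H.xCoord +
      algebraMap k H.FunctionField (M 1 1)) * h1 + algebraMap k H.FunctionField (N 0 0) * h2

theorem ActsBy.eq_scalar {M : Matrix (Fin 2) (Fin 2) k} {σ : H.Aut} (h : H.ActsBy M σ)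
    (hσ : σ ∈ H.hyperellipticSubgroup) : M = Matrix.scalar (Fin 2) (M 0 0) := by
  have h1 := h.denom_mul
  rw [(H.mem_hyperellipticSubgroup σ).1 hσ] at h1
  have h0 : C (M 1 0) * X ^ 2 + C (M 1 1 - M 0 0) * X + C (-M 0 1) = 0 := by
    apply H.aeval_xCoord_injective
    simp only [map_add, map_mul, map_pow, aeval_X, aeval_C, map_sub, map_neg, map_zero]
    linear_combination h1
  have c0 := congrArg (coeff · 0) h0
  have c1 := congrArg (coeff · 1) h0
  have c2 := congrArg (coeff · 2) h0
  simp [coeff_X, coeff_C, coeff_X_pow] at c0 c1 c2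
  ext i j
  fin_cases i <;> fin_cases j <;> simp [c0, c2]
  linear_combination c1

theorem ActsBy.det_ne_zero {M : Matrix (Fin 2) (Fin 2) k} {σ : H.Aut} (h : H.ActsBy M σ) :
    M.det ≠ 0 := by
  intro hdet
  obtain ⟨w, hw, hwM⟩ := Matrix.exists_vecMul_eq_zero_iff.2 hdet
  have e0 := congrFun hwM 0
  have e1 := congrFun hwM 1
  simp only [Matrix.vecMul, dotProduct, Fin.sum_univ_two, Pi.zero_apply] at e0 e1
  have e0 := congrArg (algebraMap k H.FunctionField) e0
  have e1 := congrArg (algebraMap k H.FunctionField) e1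
  simp only [map_add, map_mul, map_zero] at e0 e1
  have h1 : algebraMap k H.FunctionField (w 0) * σ H.xCoord +
      algebraMap k H.FunctionField (w 1) = 0 := by
    refine (mul_eq_zero.1 ?_).resolve_left h.denom_ne_zero
    linear_combination algebraMap k H.FunctionField (w 0) * h.denom_mul + H.xCoord * e0 + e1
  have h2 : σ (algebraMap k H.FunctionField (w 0) * H.xCoord +
      algebraMap k H.FunctionField (w 1)) = 0 := by
    simpa only [map_mul, map_add, AlgEquiv.commutes] using h1
  obtain ⟨h3, h4⟩ := H.eq_zero_of_linear_xCoord ((map_eq_zero_iff σ σ.injective).1 h2)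
  exact hw (by ext i; fin_cases i <;> simp [h3, h4])

theorem map_algebraMap_eq [CharZero k] (σ : H.Aut) (r : RatFunc k) :
    ∃ a : RatFunc k, σ (algebraMap (RatFunc k) H.FunctionField r) =
      algebraMap (RatFunc k) H.FunctionField a :=
  map_mem_range H.squarefree_f H.five_le_natDegree H.root_sq H.exists_eq_add_mul_root σ r

/-- Every automorphism acts on `x` by a linear fractional transformation: as `σ` restricts to an
automorphism of `k(x)`, the rational function `σ x` generates `k(x)`, hence has degree one. -/
theorem exists_actsBy [CharZero k] (σ : H.Aut) : ∃ M, H.ActsBy M σ := by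
  obtain ⟨a, ha⟩ := map_algebraMap_eq σ RatFunc.X
  let ι : RatFunc k →ₐ[k] H.FunctionField := IsScalarTower.toAlgHom k (RatFunc k) H.FunctionField
  have hι : ∀ r, ι r = algebraMap (RatFunc k) H.FunctionField r := fun r => rfl
  have htop : IntermediateField.adjoin k {a} = ⊤ := by
    apply IntermediateField.map_injective ι
    have h1 : (IntermediateField.adjoin k {a}).map ι =
        ((⊤ : IntermediateField k (RatFunc k)).map ι).map (σ : H.FunctionField →ₐ[k] _) := by
      rw [← RatFunc.adjoin_X, IntermediateField.adjoin_map, IntermediateField.adjoin_map,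
        IntermediateField.adjoin_map, Set.image_singleton, Set.image_singleton,
        Set.image_singleton, hι, ← ha]
      rfl
    rw [h1]
    ext z
    simp only [IntermediateField.mem_map, IntermediateField.mem_top, true_and]
    constructor
    · rintro ⟨_, ⟨r, rfl⟩, rfl⟩
      obtain ⟨b, hb⟩ := map_algebraMap_eq σ r
      exact ⟨b, hb.symm⟩
    · rintro ⟨r, rfl⟩
      obtain ⟨b, hb⟩ := map_algebraMap_eq σ⁻¹ r
      refine ⟨_, ⟨b, rfl⟩, ?_⟩
      rw [hι, ← hb]
      exact σ.apply_symm_apply _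
  have hdeg := RatFunc.finrank_eq_max_natDegree a
  rw [htop, IntermediateField.finrank_top] at hdeg
  obtain ⟨p, q, hp⟩ := exists_eq_X_add_C_of_natDegree_le_one
    (p := a.num) (hdeg ▸ le_max_left _ _)
  obtain ⟨r, s, hr⟩ := exists_eq_X_add_C_of_natDegree_le_one
    (p := a.denom) (hdeg ▸ le_max_right _ _)
  have hd : aeval H.xCoord a.denom ≠ 0 := fun h =>
    a.denom_ne_zero (H.aeval_xCoord_injective (by rw [h, map_zero]))
  have hmul : aeval H.xCoord a.denom * σ H.xCoord = aeval H.xCoord a.num := by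
    rw [ha]
    conv_lhs => rw [← RatFunc.num_div_denom a]
    rw [map_div₀, RatFunc.num_div_denom, algebraMap_ratFunc_algebraMap,
      algebraMap_ratFunc_algebraMap, mul_div_cancel₀ _ hd]
  rw [hp, hr] at hmul
  rw [hr] at hd
  simp only [map_add, map_mul, aeval_C, aeval_X] at hmul hd
  exact ⟨!![p, q; r, s], by simpa using hd, by simpa using hmul⟩

/-- Every automorphism multiplies `y` by a rational function of `x`. -/
theorem exists_map_root_eq [CharZero k] (σ : H.Aut) : ∃ b : RatFunc k,
    σ (AdjoinRoot.root H.equation) =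
      algebraMap (RatFunc k) H.FunctionField b * AdjoinRoot.root H.equation := by
  obtain ⟨p, q, hpq⟩ := H.exists_eq_add_mul_root (σ (AdjoinRoot.root H.equation))
  obtain ⟨e, he⟩ := map_algebraMap_eq σ (algebraMap k[X] (RatFunc k) H.f)
  have h1 := congrArg σ H.root_sq
  rw [map_pow, he, hpq] at h1
  have h2 := H.algebraMap_add_mul_root_eq_zero
    (a := p ^ 2 + q ^ 2 * algebraMap k[X] (RatFunc k) H.f - e) (b := 2 * p * q) (by
      simp only [map_add, map_sub, map_mul, map_pow, map_ofNat]
      rw [← H.root_sq]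
      linear_combination h1)
  rcases mul_eq_zero.1 h2.2 with hp | hq
  · obtain rfl : p = 0 := by simpa using hp
    exact ⟨q, by rw [hpq]; simp⟩
  · exfalso
    subst hq
    obtain ⟨b, hb⟩ := map_algebraMap_eq σ⁻¹ p
    have h3 : AdjoinRoot.root H.equation = algebraMap (RatFunc k) H.FunctionField b := by
      rw [← hb]
      have h4 : σ (AdjoinRoot.root H.equation) = algebraMap (RatFunc k) H.FunctionField p := by
        rw [hpq]; simp
      rw [← h4]
      exact (σ.symm_apply_apply _).symm
    have := (H.algebraMap_add_mul_root_eq_zero (a := -b) (b := 1) (by rw [h3]; simp)).2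
    exact one_ne_zero this

/-- The hyperelliptic involution is central in the automorphism group. -/
theorem commute_of_mem_hyperellipticSubgroup [CharZero k] {τ : H.Aut}
    (hτ : τ ∈ H.hyperellipticSubgroup) (σ : H.Aut) : σ * τ = τ * σ := by
  rw [mem_hyperellipticSubgroup] at hτ
  obtain ⟨e, he⟩ := exists_map_root_eq σ
  obtain ⟨b, hb⟩ := exists_map_root_eq τ
  have hy0 : AdjoinRoot.root H.equation ≠ 0 := fun h =>
    one_ne_zero (H.algebraMap_add_mul_root_eq_zero (a := 0) (b := 1) (by rw [h]; simp)).2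
  have hb2 : b ^ 2 = 1 := by
    have h1 := congrArg τ H.root_sq
    rw [hτ, ← H.root_sq, map_pow, hb, mul_pow] at h1
    apply (algebraMap (RatFunc k) H.FunctionField).injective
    rw [map_pow, map_one]
    exact mul_right_cancel₀ (pow_ne_zero 2 hy0) (by rw [h1, one_mul])
  have hσb : σ (algebraMap (RatFunc k) H.FunctionField b) =
      algebraMap (RatFunc k) H.FunctionField b := by
    rcases mul_self_eq_one_iff.1 ((sq b).symm.trans hb2) with rfl | rfl <;> simp
  ext z
  obtain ⟨p, q, rfl⟩ := H.exists_eq_add_mul_root z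
  obtain ⟨p', hp'⟩ := map_algebraMap_eq σ p
  obtain ⟨q', hq'⟩ := map_algebraMap_eq σ q
  simp only [AlgEquiv.mul_apply, map_add, map_mul, hτ, hb, he, hp', hq', hσb]
  ring

end Moebius

/-! ### Semi-invariance of the binary form, and the vanishing of `I₄` -/

section Form

variable {k : Type*} [Field k] (H : HyperellipticCurve k)

theorem natDegree_f_le_order : H.f.natDegree ≤ H.order := by
  have := H.natDegree_f
  simp only [order]
  omega

theorem isHomogeneous_form : H.form.IsHomogeneous H.order := by
  refine MvPolynomial.IsHomogeneous.sum _ _ _ fun i hi => ?_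
  have hi : i ≤ H.order := Nat.lt_succ_iff.1 (Finset.mem_range.1 hi)
  have := ((MvPolynomial.isHomogeneous_X k (0 : Fin 2)).pow i).mul
    ((MvPolynomial.isHomogeneous_X k (1 : Fin 2)).pow (H.order - i))
  rw [one_mul, one_mul, Nat.add_sub_cancel' hi] at this
  rw [mul_assoc]
  exact this.C_mul _

theorem aeval_form {A : Type*} [CommRing A] [Algebra k A] (w v : A) :
    MvPolynomial.aeval ![v * w, v] H.form = v ^ H.order * aeval w H.f := by
  rw [form, map_sum, aeval_eq_sum_range' (Nat.lt_succ_of_le H.natDegree_f_le_order),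
    Finset.mul_sum]
  refine Finset.sum_congr rfl fun i hi => ?_
  have hi : i ≤ H.order := Nat.lt_succ_iff.1 (Finset.mem_range.1 hi)
  simp only [map_mul, map_pow, MvPolynomial.aeval_X, MvPolynomial.aeval_C, Matrix.cons_val_zero,
    Matrix.cons_val_one, Algebra.smul_def]
  rw [← Nat.add_sub_cancel' hi, pow_add, Nat.add_sub_cancel' hi]
  ring

theorem natDegree_aeval_X_one_le {p : MvPolynomial (Fin 2) k} {n : ℕ} (hp : p.IsHomogeneous n) :
    (MvPolynomial.aeval ![(X : k[X]), 1] p).natDegree ≤ n := by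
  rw [p.as_sum, map_sum]
  refine natDegree_sum_le_of_forall_le _ _ fun m hm => ?_
  have hw : m 0 + m 1 = n := by
    have := hp (MvPolynomial.mem_support_iff.1 hm)
    simpa [Finsupp.weight_apply, Finsupp.sum_fintype, Fin.sum_univ_two] using this
  rw [MvPolynomial.aeval_monomial]
  simp only [Finsupp.prod_fintype, Fin.prod_univ_two, Matrix.cons_val_zero, Matrix.cons_val_one,
    one_pow, mul_one, pow_zero, implies_true, ← C_eq_algebraMap]
  exact (natDegree_C_mul_X_pow_le _ _).trans (by omega)

/-- A polynomial of degree at most `deg f + 1` which differs from the squarefree polynomial `f` by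
the square of a rational function is a constant multiple of `f`. -/
theorem exists_eq_C_mul_of_eq_sq_mul {f G : k[X]} (hf : Squarefree f)
    (hdeg : G.natDegree ≤ f.natDegree + 1) (r : RatFunc k)
    (e : algebraMap k[X] (RatFunc k) G = r ^ 2 * algebraMap k[X] (RatFunc k) f) :
    ∃ c, G = C c * f := by
  obtain ⟨q, hq⟩ := dvd_of_sq_mul hf _ e
  have hf0 : f ≠ 0 := hf.ne_zero
  have hfR : algebraMap k[X] (RatFunc k) f ≠ 0 := fun h0 =>
    hf0 (IsFractionRing.injective k[X] (RatFunc k) (by rw [h0, map_zero]))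
  have hq2 : r ^ 2 = algebraMap k[X] (RatFunc k) q :=
    mul_right_cancel₀ hfR (by rw [← e, hq, map_mul, mul_comm])
  obtain ⟨t, ht⟩ : ∃ t, algebraMap k[X] (RatFunc k) t = r := by
    refine IsIntegrallyClosed.isIntegral_iff.mp ⟨X ^ 2 - C q, monic_X_pow_sub_C _ two_ne_zero, ?_⟩
    simp only [eval₂_sub, eval₂_X_pow, eval₂_C]
    rw [hq2, sub_self]
  have hqt : q = t ^ 2 := IsFractionRing.injective k[X] (RatFunc k) (by rw [map_pow, ht, hq2])
  have ht0 : t.natDegree = 0 := by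
    by_cases h0 : t = 0
    · simp [h0]
    have h1 : G.natDegree = f.natDegree + 2 * t.natDegree := by
      rw [hq, hqt, natDegree_mul hf0 (pow_ne_zero 2 h0), natDegree_pow]
    omega
  obtain ⟨c, rfl⟩ := natDegree_eq_zero.1 ht0
  exact ⟨c ^ 2, by rw [hq, hqt, map_pow, mul_comm]⟩

theorem aeval_aeval_X_one {A : Type*} [CommRing A] [Algebra k A] (x : A)
    (p : MvPolynomial (Fin 2) k) :
    aeval x (MvPolynomial.aeval ![(X : k[X]), 1] p) = MvPolynomial.aeval ![x, 1] p := by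
  rw [← AlgHom.comp_apply]
  congr 1
  apply MvPolynomial.algHom_ext
  intro i
  fin_cases i <;> simp

/-- The dehomogenized form of the curve, after substitution of the matrix of `σ`, differs from `f`
by the square of a rational function, namely of the factor by which `σ` multiplies `y`, times a power
of the denominator of `σ x`. -/
theorem ActsBy.exists_dehomogenized_eq_sq_mul [CharZero k] {H : HyperellipticCurve k}
    {M : Matrix (Fin 2) (Fin 2) k} {σ : H.Aut} (h : H.ActsBy M σ) :
    ∃ r : RatFunc k, algebraMap k[X] (RatFunc k)
      (MvPolynomial.aeval ![(X : k[X]), 1] (linearSubst M H.form)) =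
        r ^ 2 * algebraMap k[X] (RatFunc k) H.f := by
  obtain ⟨b, hb⟩ := exists_map_root_eq σ
  have hdim : H.order = (H.g + 1) * 2 := by simp only [order]; ring
  obtain ⟨D, hD⟩ : ∃ D : k[X], aeval H.xCoord D =
      algebraMap k H.FunctionField (M 1 0) * H.xCoord + algebraMap k H.FunctionField (M 1 1) :=
    ⟨C (M 1 0) * X + C (M 1 1), by simp⟩
  refine ⟨algebraMap k[X] (RatFunc k) D ^ (H.g + 1) * b, ?_⟩
  apply (algebraMap (RatFunc k) H.FunctionField).injective
  have hσf : aeval (σ H.xCoord) H.f =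
      (algebraMap (RatFunc k) H.FunctionField b * AdjoinRoot.root H.equation) ^ 2 := by
    have h1 : aeval (σ H.xCoord) H.f = σ (aeval H.xCoord H.f) := aeval_algHom_apply σ H.xCoord H.f
    rw [h1, ← algebraMap_ratFunc_algebraMap, ← H.root_sq, map_pow, hb]
  rw [map_mul, map_pow, map_mul, map_pow, algebraMap_ratFunc_algebraMap,
    algebraMap_ratFunc_algebraMap H D, ← H.root_sq, aeval_aeval_X_one, aeval_linearSubst, mul_one,
    mul_one, ← h.denom_mul, aeval_form, hσf, hD, hdim, pow_mul, mul_pow, mul_pow, mul_assoc]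

/-- The binary form of the curve is a semi-invariant of the matrix of every automorphism. -/
theorem ActsBy.exists_linearSubst_form [CharZero k] {H : HyperellipticCurve k}
    {M : Matrix (Fin 2) (Fin 2) k} {σ : H.Aut} (h : H.ActsBy M σ) :
    ∃ c, linearSubst M H.form = MvPolynomial.C c * H.form := by
  obtain ⟨r, hr⟩ := h.exists_dehomogenized_eq_sq_mul
  have hM := isHomogeneous_linearSubst M H.isHomogeneous_form
  obtain ⟨c, hc⟩ := exists_eq_C_mul_of_eq_sq_mul H.squarefree_f
    ((natDegree_aeval_X_one_le hM).trans (by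
      have := H.natDegree_f
      simp only [order]
      omega)) r hr
  refine ⟨c, ?_⟩
  have hform : MvPolynomial.aeval ![(X : k[X]), 1] H.form = H.f := by
    simpa using H.aeval_form (X : k[X]) 1
  rw [← homogenize_eq_of_isHomogeneous hM hc, homogenize_C_mul,
    homogenize_eq_of_isHomogeneous H.isHomogeneous_form hform]

theorem isHomogeneous_J₄ : H.J₄.IsHomogeneous 4 := by
  have := isHomogeneous_transvection (r := H.order - 2) H.isHomogeneous_form H.isHomogeneous_form
  rwa [show H.order - (H.order - 2) + (H.order - (H.order - 2)) = 4 by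
    simp only [order]; omega] at this

theorem ActsBy.exists_linearSubst_J₄ [CharZero k] {H : HyperellipticCurve k}
    {M : Matrix (Fin 2) (Fin 2) k} {σ : H.Aut} (h : H.ActsBy M σ) :
    ∃ c, linearSubst M H.J₄ = MvPolynomial.C c * H.J₄ := by
  obtain ⟨c, hc⟩ := h.exists_linearSubst_form
  have h1 := transvection_linearSubst M H.order H.order (H.order - 2) H.form H.form
  rw [hc, transvection_C_mul] at h1
  refine ⟨(M.det ^ (H.order - 2))⁻¹ * (c * c), ?_⟩
  have hd : M.det ^ (H.order - 2) ≠ 0 := pow_ne_zero _ h.det_ne_zero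
  rw [map_mul, mul_assoc, J₄, h1, ← mul_assoc, ← map_mul, inv_mul_cancel₀ hd, map_one, one_mul]

/-- The invariant `I₄` vanishes as soon as the reduced automorphism group contains two elements of
order three which do not commute. -/
theorem I₄_eq_zero_of_not_commute [IsAlgClosed k] [CharZero k] {s t : H.ReducedAut}
    (hs : s ^ 3 = 1) (ht : t ^ 3 = 1) (hst : s * t ≠ t * s) : H.I₄ = 0 := by
  obtain ⟨σ, rfl⟩ := QuotientGroup.mk_surjective s
  obtain ⟨τ, rfl⟩ := QuotientGroup.mk_surjective t
  obtain ⟨M, hM⟩ := exists_actsBy σ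
  obtain ⟨N, hN⟩ := exists_actsBy τ
  obtain ⟨μ, hμ⟩ := hM.exists_linearSubst_J₄
  obtain ⟨ν, hν⟩ := hN.exists_linearSubst_J₄
  have hcube : ∀ {ρ : H.Aut} {A : Matrix (Fin 2) (Fin 2) k}, (ρ : H.ReducedAut) ^ 3 = 1 →
      H.ActsBy A ρ → A ^ 3 = Matrix.scalar (Fin 2) ((A ^ 3) 0 0) := by
    intro ρ A hρ hA
    rw [← QuotientGroup.mk_pow, QuotientGroup.eq_one_iff] at hρ
    refine ActsBy.eq_scalar ?_ hρ
    simp only [pow_succ, pow_zero, one_mul, mul_assoc A A A]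
    exact (hA.mul hA).mul hA
  refine transvection_self_eq_zero_of_semiinvariant H.isHomogeneous_J₄ hM.det_ne_zero
    hN.det_ne_zero (hcube hs hM) (hcube ht hN) (fun hMN => hst ?_) hμ hν
  have h1 := hN.mul hM
  have h2 := hM.mul hN
  rw [← hMN] at h2
  have hx : (τ * σ) H.xCoord = (σ * τ) H.xCoord :=
    mul_left_cancel₀ h1.denom_ne_zero (h1.denom_mul.trans h2.denom_mul.symm)
  rw [← QuotientGroup.mk_mul, ← QuotientGroup.mk_mul, QuotientGroup.eq]
  apply H.mem_hyperellipticSubgroup_of_xCoord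
  rw [AlgEquiv.mul_apply, hx]
  exact (σ * τ).symm_apply_apply _

/-- The same conclusion, read off from the full automorphism group: as the hyperelliptic involution
is central, the images of two automorphisms in the reduced group do not commute if their commutator
is not central. -/
theorem I₄_eq_zero_of_commutator_not_central [IsAlgClosed k] [CharZero k] {G : Type*} [Group G]
    (e : H.Aut ≃* G) {s t : G} (hs : s ^ 3 = 1) (ht : t ^ 3 = 1)
    (hst : s * ⁅s, t⁆ ≠ ⁅s, t⁆ * s) : H.I₄ = 0 := by
  have hcube : ∀ {a : G}, a ^ 3 = 1 → ((e.symm a : H.Aut) : H.ReducedAut) ^ 3 = 1 := by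
    intro a ha
    rw [← QuotientGroup.mk_pow, ← map_pow, ha, map_one, QuotientGroup.mk_one]
  refine H.I₄_eq_zero_of_not_commute (hcube hs) (hcube ht) fun h => hst ?_
  have hmem : e.symm ⁅s, t⁆ ∈ H.hyperellipticSubgroup := by
    rw [← QuotientGroup.eq_one_iff, map_commutatorElement]
    exact commutatorElement_eq_one_iff_mul_comm.2 h
  simpa using congrArg e (commute_of_mem_hyperellipticSubgroup hmem (e.symm s))

end Form

end HyperellipticCurve

theorem lemma4p3 {k : Type*} [Field k] [IsAlgClosed k] [CharZero k] (H : HyperellipticCurve k) :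
    (Nonempty (H.ReducedAut ≃* alternatingGroup (Fin 4)) → H.I₄ = 0) ∧
    (Nonempty (H.Aut ≃* Multiplicative (ZMod 2) × alternatingGroup (Fin 4)) ∨
      Nonempty (H.Aut ≃* Matrix.SpecialLinearGroup (Fin 2) (ZMod 3)) → H.I₄ = 0) := by
  -- The 3-cycles `(0 1 2)` and `(0 1 3)` generate `A₄`; their commutator is a product of two
  -- disjoint transpositions, which does not commute with the first.
  obtain ⟨s, t, hs, ht, hst, hcomm⟩ : ∃ s t : alternatingGroup (Fin 4), s ^ 3 = 1 ∧ t ^ 3 = 1 ∧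
      s * t ≠ t * s ∧ s * ⁅s, t⁆ ≠ ⁅s, t⁆ * s :=
    ⟨⟨c[0, 1, 2], Equiv.Perm.mem_alternatingGroup.2 (by decide)⟩,
      ⟨c[0, 1, 3], Equiv.Perm.mem_alternatingGroup.2 (by decide)⟩, by decide, by decide, by decide,
      by decide⟩
  refine ⟨?_, ?_⟩
  · rintro ⟨e⟩
    refine H.I₄_eq_zero_of_not_commute (s := e.symm s) (t := e.symm t) ?_ ?_ ?_
    · rw [← map_pow, hs, map_one]
    · rw [← map_pow, ht, map_one]
    · rw [← map_mul, ← map_mul]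
      exact fun h => hst (e.symm.injective h)
  · rintro (⟨⟨e⟩⟩ | ⟨⟨e⟩⟩)
    · refine H.I₄_eq_zero_of_commutator_not_central e (s := (1, s)) (t := (1, t)) ?_ ?_ ?_
      · rw [Prod.pow_mk, hs, one_pow]; rfl
      · rw [Prod.pow_mk, ht, one_pow]; rfl
      · exact fun h => hcomm (congrArg Prod.snd h)
    · refine H.I₄_eq_zero_of_commutator_not_central e (s := ⟨!![1, 1; 0, 1], by decide⟩)
        (t := ⟨!![1, 0; 1, 1], by decide⟩) ?_ ?_ ?_ <;> decide
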